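/- Let $\mathbb N_0=\{0,1,2,\dots\}$. A length function on a group $G$ is a map $\ell\colon G\to\mathbb N_0$ such that, for all $g,h\in G$: $\ell(g)=0$ if and only if $g=1$; $\ell(g)=\ell(g^{-1})$; and $\ell(gh)\le \ell(g)+\ell(h)$. Let $L(G)$ be the set of all length functions on $G$ with the topology of pointwise convergence. We call $\ell\in L(G)$ a word length if there is a generating set $X$ of $G$ such that, for every $g\in G$, $\ell(g)$ is the length of a shortest word in the alphabet $X\cup X^{-1}$ representing $g$. The Cayley graph of $\ell\in L(G)$ is the graph with vertex set $G$ in which $a,b\in G$ are adjacent if and only if $\ell(a^{-1}b)=1$. A group $G$ is mixed identity free (MIF) if there is no non-trivial element $w$ of the free product $G\ast\mathbb Z$ such that $\alpha(w)=1$ for every homomorphism $\alpha\colon G\ast\mathbb Z\to G$ satisfying $\alpha(g)=g$ for all $g\in G$. There is a countable graph $U$ (the Moss graph), unique up to isomorphism, such that, with respect to graph distances, $U$ is connected, every finite connected graph embeds isometrically into $U$, and every isometry between two finite sets of vertices of $U$ (with the distance induced from $U$) extends to an automorphism of $U$. **Theorem 1.4.** For every countable MIF group $G$, there is a comeager subset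 $C\subseteq L(G)$ such that every $\ell\in C$ is a word length and the Cayley graph of every $\ell\in C$ is isomorphic to $U$. -/

import Mathlib

/-- Integer-valued length functions on a group. -/
structure IsLengthFunction {G : Type*} [Group G] (l : G → ℕ) : Prop where
  eq_zero_iff : ∀ g : G, l g = 0 ↔ g = 1
  map_inv : ∀ g : G, l g = l g⁻¹
  map_mul_le : ∀ g h : G, l (g * h) ≤ l g + l h

/-- The space `L(G)` of length functions on `G`. As a subtype of `G → ℕ` it carries the subspace
topology of the product of discrete spaces, i.e. the topology of pointwise convergence. -/
abbrev LengthFunction (G : Type*) [Group G] : Type _ :=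
  {l : G → ℕ // IsLengthFunction l}

/-- `l` is a word length: for some generating set `X` of `G`, the value `l g` is the length of a
shortest word in the alphabet `X ∪ X⁻¹` representing `g`. -/
def IsWordLength {G : Type*} [Group G] (l : LengthFunction G) : Prop :=
  ∃ X : Set G, Subgroup.closure X = ⊤ ∧
    ∀ g : G, IsLeast
      {n : ℕ | ∃ w : List G, (∀ x ∈ w, x ∈ X ∨ x⁻¹ ∈ X) ∧ w.prod = g ∧ w.length = n} (l.1 g)

/-- The (unoriented, unlabeled) Cayley graph of a length function: the vertex set is `G`, and
`a`, `b` are adjacent if and only if `l (a⁻¹ * b) = 1`. -/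
def cayleyGraph {G : Type*} [Group G] (l : LengthFunction G) : SimpleGraph G where
  Adj a b := l.1 (a⁻¹ * b) = 1
  symm := ⟨fun a b h => by
    have h2 := l.2.map_inv (a⁻¹ * b)
    rw [mul_inv_rev, inv_inv] at h2
    rw [← h2]
    exact h⟩
  loopless := ⟨fun a h => by
    have h2 := (l.2.eq_zero_iff (a⁻¹ * a)).2 (inv_mul_cancel a)
    rw [h2] at h
    exact zero_ne_one h⟩

/-- `G` is mixed identity free: no non-trivial element `w` of the free product `G ∗ ℤ` is killed
by every homomorphism `G ∗ ℤ → G` that is the identity on `G`. -/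
def IsMIF (G : Type*) [Group G] : Prop :=
  ¬ ∃ w : Monoid.Coprod G (Multiplicative ℤ), w ≠ 1 ∧
    ∀ α : Monoid.Coprod G (Multiplicative ℤ) →* G,
      (∀ g : G, α (Monoid.Coprod.inl g) = g) → α w = 1

/-- The defining properties of the universal graph for isometric embeddings. Distances are graph
distances, and a finite graph is taken, up to isomorphism, on the vertex set `Fin n`. -/
structure IsMossGraph {V : Type*} (U : SimpleGraph V) : Prop where
  countable : Countable V
  connected : U.Connected
  /-- Every finite connected graph embeds isometrically. -/
  universal : ∀ (n : ℕ) (H : SimpleGraph (Fin n)), H.Connected →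
    ∃ f : Fin n → V, ∀ x y : Fin n, U.dist (f x) (f y) = H.dist x y
  /-- Every isometry between finite sets of vertices extends to an automorphism. -/
  homogeneous : ∀ A B : Set V, A.Finite → B.Finite → ∀ f : A ≃ B,
    (∀ x y : A, U.dist (f x : V) (f y : V) = U.dist (x : V) (y : V)) →
      ∃ φ : U ≃g U, ∀ x : A, φ (x : V) = (f x : V)

/-! Call an integral metric Urysohn if every admissible prescription of distances to finitely many
points is realised. Such a metric is the graph distance of its distance-one graph, since geodesics
can be filled in point by point, and countable ones are unique by back-and-forth. On countable sets,
Moss graphs are exactly the distance-one graphs of such metrics (`IsUrysohn.isMossGraph`,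
`IsMossGraph.isUrysohn`). So it suffices that `l (a⁻¹ * b)` is Urysohn for generic `l`. There are
countably many extension problems, each solved on an open set, so only density needs an argument
(`IsMIF.exists_lengthFunction`).

For density, a free letter `t` serves as the missing point: in `G ∗ ℤ` each `t⁻¹ * a` receives its
prescribed length, and `l` is kept on a finite set. Normal forms show that no product of letters
undercuts these values (`exists_splitCost`). Only finitely many elements of `G ∗ ℤ` are short, and
MIF gives a retraction to `G` killing none of them except 1 (`IsMIF.exists_retraction`). The length
it induces on `G` keeps all the chosen values. -/

/-! ### Integral Urysohn metrics and back-and-forth -/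

/-- `d` is a metric with values in the natural numbers. -/
structure IsNatMetric {V : Type*} (d : V → V → ℕ) : Prop where
  eq_zero_iff : ∀ x y, d x y = 0 ↔ x = y
  symm : ∀ x y, d x y = d y x
  triangle : ∀ x y z, d x z ≤ d x y + d y z

/-- The finite set `P` of pairs (point, prescribed distance) satisfies the triangle inequalities
that are necessary for the existence of a point at the prescribed distances. -/
def IsKatetov {V : Type*} (d : V → V → ℕ) (P : Finset (V × ℕ)) : Prop :=
  ∀ p ∈ P, ∀ q ∈ P, p.2 ≤ q.2 + d p.1 q.1 ∧ d p.1 q.1 ≤ p.2 + q.2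

/-- `d` is an integral Urysohn metric: every admissible one-point extension of a finite subset is
realised. -/
structure IsUrysohn {V : Type*} (d : V → V → ℕ) : Prop extends IsNatMetric d where
  exists_of_pos : ∀ P : Finset (V × ℕ), IsKatetov d P → (∀ p ∈ P, 1 ≤ p.2) →
    ∃ v, ∀ p ∈ P, d v p.1 = p.2

namespace IsNatMetric

variable {V : Type*} {d : V → V → ℕ}

theorem self (hd : IsNatMetric d) (x : V) : d x x = 0 := (hd.eq_zero_iff x x).2 rfl

end IsNatMetric

namespace IsUrysohn

variable {V W : Type*} {d : V → V → ℕ} {e : W → W → ℕ}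

/-- A prescribed distance 0 makes its own base point the solution: the triangle inequalities then
force all the other values. -/
theorem exists_of_isKatetov (hd : IsUrysohn d) (P : Finset (V × ℕ)) (hP : IsKatetov d P) :
    ∃ v, ∀ p ∈ P, d v p.1 = p.2 := by
  by_cases h : ∀ p ∈ P, 1 ≤ p.2
  · exact hd.exists_of_pos P hP h
  · push Not at h
    obtain ⟨p, hp, hp1⟩ := h
    refine ⟨p.1, fun q hq => ?_⟩
    have h1 := hP p hp q hq
    have h2 := hP q hq p hp
    rw [hd.symm q.1 p.1] at h2
    omega

theorem nonempty (hd : IsUrysohn d) : Nonempty V :=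
  (hd.exists_of_pos ∅ (by simp [IsKatetov]) (by simp)).nonempty

/-- One-point extension of a finite partial isometry. -/
theorem exists_extension (hd : IsNatMetric d) (he : IsUrysohn e) (S : Finset (V × W))
    (hS : ∀ p ∈ S, ∀ q ∈ S, d p.1 q.1 = e p.2 q.2) (v : V) :
    ∃ w, ∀ p ∈ S, d v p.1 = e w p.2 := by
  classical
  obtain ⟨w, hw⟩ := he.exists_of_isKatetov (S.image fun p => (p.2, d v p.1)) (by
    intro p hp q hq
    obtain ⟨p, hp', rfl⟩ := Finset.mem_image.1 hp
    obtain ⟨q, hq', rfl⟩ := Finset.mem_image.1 hq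
    dsimp only
    rw [← hS p hp' q hq']
    have h1 := hd.triangle v q.1 p.1
    have h2 := hd.triangle p.1 v q.1
    rw [hd.symm q.1 p.1] at h1
    rw [hd.symm p.1 v] at h2
    exact ⟨h1, h2⟩)
  exact ⟨w, fun p hp => (hw _ (Finset.mem_image_of_mem _ hp)).symm⟩

/-- A finite set with a natural-number-valued metric embeds into an integral Urysohn space. -/
theorem exists_isometry (hd : IsNatMetric d) (he : IsUrysohn e) (s : Finset V) :
    ∃ f : V → W, ∀ x ∈ s, ∀ y ∈ s, e (f x) (f y) = d x y := by
  classical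
  induction s using Finset.induction_on with
  | empty => exact ⟨fun _ => he.nonempty.some, by simp⟩
  | insert a s ha ih =>
    obtain ⟨f, hf⟩ := ih
    obtain ⟨w, hw⟩ := exists_extension hd he (s.image fun x => (x, f x)) (by
      intro p hp q hq
      obtain ⟨x, hx, rfl⟩ := Finset.mem_image.1 hp
      obtain ⟨y, hy, rfl⟩ := Finset.mem_image.1 hq
      exact (hf x hx y hy).symm) a
    have hw' : ∀ x ∈ s, d a x = e w (f x) := fun x hx =>
      hw _ (Finset.mem_image_of_mem (fun x => (x, f x)) hx)
    have hne : ∀ x ∈ s, x ≠ a := fun x hx h => ha (h ▸ hx)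
    refine ⟨Function.update f a w, fun x hx y hy => ?_⟩
    rcases Finset.mem_insert.1 hx with rfl | hx' <;> rcases Finset.mem_insert.1 hy with rfl | hy'
    · simp [hd.self, he.self]
    · rw [Function.update_self, Function.update_of_ne (hne y hy'), hw' y hy']
    · rw [Function.update_self, Function.update_of_ne (hne x hx'), he.symm, hd.symm, hw' x hx']
    · rw [Function.update_of_ne (hne x hx'), Function.update_of_ne (hne y hy'), hf x hx' y hy']

/-- Finite partial isometries between two spaces, ordered by inclusion. -/
abbrev PartialIsometry (d : V → V → ℕ) (e : W → W → ℕ) : Type _ :=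
  {S : Finset (V × W) // ∀ p ∈ S, ∀ q ∈ S, d p.1 q.1 = e p.2 q.2}

theorem isCofinal_left (hd : IsNatMetric d) (he : IsUrysohn e) (v : V) :
    IsCofinal {S : PartialIsometry d e | ∃ w, (v, w) ∈ S.1} := by
  classical
  rintro ⟨S, hS⟩
  obtain ⟨w, hw⟩ := exists_extension hd he S hS v
  refine ⟨⟨insert (v, w) S, ?_⟩, ⟨w, Finset.mem_insert_self _ _⟩, Finset.subset_insert _ _⟩
  intro p hp q hq
  rcases Finset.mem_insert.1 hp with rfl | hp <;> rcases Finset.mem_insert.1 hq with rfl | hq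
  · simp [hd.self, he.self]
  · exact hw q hq
  · rw [hd.symm, he.symm, hw p hp]
  · exact hS p hp q hq

theorem isCofinal_right (hd : IsUrysohn d) (he : IsNatMetric e) (w : W) :
    IsCofinal {S : PartialIsometry d e | ∃ v, (v, w) ∈ S.1} := by
  classical
  rintro ⟨S, hS⟩
  obtain ⟨v, hv⟩ := exists_extension he hd (S.image Prod.swap) (by
    intro p hp q hq
    obtain ⟨p, hp', rfl⟩ := Finset.mem_image.1 hp
    obtain ⟨q, hq', rfl⟩ := Finset.mem_image.1 hq
    exact (hS p hp' q hq').symm) w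
  have hv' : ∀ p ∈ S, e w p.2 = d v p.1 := fun p hp => hv _ (Finset.mem_image_of_mem _ hp)
  refine ⟨⟨insert (v, w) S, ?_⟩, ⟨v, Finset.mem_insert_self _ _⟩, Finset.subset_insert _ _⟩
  intro p hp q hq
  rcases Finset.mem_insert.1 hp with rfl | hp <;> rcases Finset.mem_insert.1 hq with rfl | hq
  · simp [hd.self, he.self]
  · exact (hv' q hq).symm
  · rw [hd.symm, he.symm, hv' p hp]
  · exact hS p hp q hq

/-- Back-and-forth: a finite partial isometry between countable integral Urysohn spaces extends to
an isometric bijection. -/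
theorem exists_equiv [Countable V] [Countable W] (hd : IsUrysohn d) (he : IsUrysohn e)
    (S : PartialIsometry d e) :
    ∃ φ : V ≃ W, (∀ x y, e (φ x) (φ y) = d x y) ∧ ∀ p ∈ S.1, φ p.1 = p.2 := by
  classical
  obtain ⟨_⟩ := nonempty_encodable (V ⊕ W)
  let D : V ⊕ W → Order.Cofinal (PartialIsometry d e) := fun i => i.elim
    (fun v => ⟨_, isCofinal_left hd.toIsNatMetric he v⟩)
    (fun w => ⟨_, isCofinal_right hd he.toIsNatMetric w⟩)
  let I := Order.idealOfCofinals S D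
  have hS : S ∈ I := Order.mem_idealOfCofinals S D
  have hl : ∀ v, ∃ w, ∃ T ∈ I, (v, w) ∈ T.1 := fun v => by
    obtain ⟨T, ⟨w, hw⟩, hT⟩ := Order.cofinal_meets_idealOfCofinals S D (Sum.inl v)
    exact ⟨w, T, hT, hw⟩
  have hr : ∀ w, ∃ v, ∃ T ∈ I, (v, w) ∈ T.1 := fun w => by
    obtain ⟨T, ⟨v, hv⟩, hT⟩ := Order.cofinal_meets_idealOfCofinals S D (Sum.inr w)
    exact ⟨v, T, hT, hv⟩
  have key : ∀ v w v' w', (∃ T ∈ I, (v, w) ∈ T.1) → (∃ T ∈ I, (v', w') ∈ T.1) →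
      d v v' = e w w' := by
    rintro v w v' w' ⟨T, hT, hv⟩ ⟨T', hT', hv'⟩
    obtain ⟨R, -, h1, h2⟩ := I.directed T hT T' hT'
    exact R.2 _ (h1 hv) _ (h2 hv')
  choose f hf using hl
  choose g hg using hr
  refine ⟨⟨f, g, fun v => ?_, fun w => ?_⟩, fun x y => (key _ _ _ _ (hf x) (hf y)).symm,
    fun p hp => ?_⟩
  · rw [← hd.eq_zero_iff, key _ _ _ _ (hg (f v)) (hf v), he.self]
  · rw [← he.eq_zero_iff, ← key _ _ _ _ (hf (g w)) (hg w), hd.self]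
  · change f p.1 = p.2
    rw [← he.eq_zero_iff, ← key _ _ _ _ (hf p.1) ⟨S, hS, hp⟩, hd.self]

/-! ### The distance-one graph of an integral Urysohn metric -/

/-- The graph joining the points at distance one. -/
def _root_.IsNatMetric.graph (hd : IsNatMetric d) : SimpleGraph V where
  Adj x y := d x y = 1
  symm := ⟨fun x y h => by rw [hd.symm]; exact h⟩
  loopless := ⟨fun x h => by rw [hd.self] at h; exact zero_ne_one h⟩

theorem exists_intermediate (hd : IsUrysohn d) {x y : V} {n : ℕ} (h : d x y = n + 1) :
    ∃ v, d x v = 1 ∧ d v y = n := by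
  classical
  -- For `n = 0` the value 0 is prescribed at `y`, so the version without positivity is needed.
  obtain ⟨v, hv⟩ := hd.exists_of_isKatetov {(x, 1), (y, n)} (by
    have h0 := hd.self
    have h' := hd.symm y x
    simp only [IsKatetov, Finset.mem_insert, Finset.mem_singleton]
    rintro p (rfl | rfl) q (rfl | rfl) <;> simp [h0, h', h] <;> omega)
  exact ⟨v, by rw [hd.symm]; exact hv (x, 1) (by simp), hv (y, n) (by simp)⟩

theorem exists_walk (hd : IsUrysohn d) (x y : V) :
    ∃ p : hd.toIsNatMetric.graph.Walk x y, p.length = d x y := by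
  obtain ⟨n, hn⟩ : ∃ n, d x y = n := ⟨_, rfl⟩
  rw [hn]
  induction n generalizing x with
  | zero =>
    obtain rfl := (hd.eq_zero_iff x y).1 hn
    exact ⟨.nil, rfl⟩
  | succ n ih =>
    obtain ⟨v, hv, hv'⟩ := hd.exists_intermediate hn
    obtain ⟨p, hp⟩ := ih v hv'
    have hxv : hd.toIsNatMetric.graph.Adj x v := hv
    exact ⟨.cons hxv p, by rw [SimpleGraph.Walk.length_cons, hp]⟩

theorem le_length (hd : IsNatMetric d) {x y : V} (p : hd.graph.Walk x y) : d x y ≤ p.length := by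
  induction p with
  | nil => simp [hd.self]
  | @cons u v w h p ih =>
    have h1 : d u v = 1 := h
    have := hd.triangle u v w
    rw [SimpleGraph.Walk.length_cons]
    omega

theorem graph_connected (hd : IsUrysohn d) : hd.toIsNatMetric.graph.Connected :=
  have := hd.nonempty
  ⟨fun x y => ⟨(hd.exists_walk x y).choose⟩⟩

theorem graph_dist (hd : IsUrysohn d) (x y : V) : hd.toIsNatMetric.graph.dist x y = d x y := by
  obtain ⟨p, hp⟩ := hd.exists_walk x y
  obtain ⟨q, hq⟩ := hd.graph_connected.exists_walk_length_eq_dist x y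
  exact le_antisymm (hp ▸ SimpleGraph.dist_le p) (hq ▸ le_length hd.toIsNatMetric q)

end IsUrysohn

theorem SimpleGraph.Connected.isNatMetric {V : Type*} {H : SimpleGraph V} (h : H.Connected) :
    IsNatMetric H.dist where
  eq_zero_iff _ _ := h.dist_eq_zero_iff
  symm _ _ := SimpleGraph.dist_comm
  triangle _ _ _ := h.dist_triangle

theorem IsUrysohn.isMossGraph {V : Type*} [Countable V] {d : V → V → ℕ} (hd : IsUrysohn d) :
    IsMossGraph hd.toIsNatMetric.graph where
  countable := inferInstance
  connected := hd.graph_connected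
  universal n H hH := by
    obtain ⟨f, hf⟩ := hd.exists_isometry hH.isNatMetric Finset.univ
    exact ⟨f, fun x y => by rw [hd.graph_dist, hf x (by simp) y (by simp)]⟩
  homogeneous A B hA hB f hf := by
    classical
    have := hA.fintype
    obtain ⟨φ, hφ, hφ'⟩ := exists_equiv hd hd
      ⟨Finset.univ.image fun x : A => ((x : V), (f x : V)), by
        intro p hp q hq
        obtain ⟨x, -, rfl⟩ := Finset.mem_image.1 hp
        obtain ⟨y, -, rfl⟩ := Finset.mem_image.1 hq
        simpa only [hd.graph_dist] using (hf x y).symm⟩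
    exact ⟨⟨φ, fun {x y} => by change d _ _ = 1 ↔ d _ _ = 1; rw [hφ]⟩, fun x =>
      hφ' _ (Finset.mem_image_of_mem (fun x : A => ((x : V), (f x : V))) (Finset.mem_univ x))⟩

/-- The graphs of two countable integral Urysohn spaces are isomorphic. -/
theorem IsUrysohn.nonempty_iso {V W : Type*} [Countable V] [Countable W] {d : V → V → ℕ}
    {e : W → W → ℕ} (hd : IsUrysohn d) (he : IsUrysohn e) :
    Nonempty (hd.toIsNatMetric.graph ≃g he.toIsNatMetric.graph) := by
  obtain ⟨φ, hφ, -⟩ := exists_equiv hd he ⟨∅, by simp⟩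
  exact ⟨⟨φ, fun {x y} => by change e _ _ = 1 ↔ d _ _ = 1; rw [hφ]⟩⟩

/-! ### Katetov functions and genericity -/

/-- Taking `f x` to be the minimum of `p.2 + d x p.1` over `P` gives distances from a new point to
the whole space. -/
theorem IsKatetov.exists_extension {V : Type*} {d : V → V → ℕ} (hd : IsNatMetric d)
    {P : Finset (V × ℕ)} (hP : IsKatetov d P) (hpos : ∀ p ∈ P, 1 ≤ p.2) (hne : P.Nonempty) :
    ∃ f : V → ℕ, (∀ p ∈ P, f p.1 = p.2) ∧ (∀ x, 1 ≤ f x) ∧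
      ∀ x y, f x ≤ f y + d x y ∧ d x y ≤ f x + f y := by
  let f : V → ℕ := fun x => P.inf' hne fun p => p.2 + d x p.1
  have hle : ∀ x, ∀ p ∈ P, f x ≤ p.2 + d x p.1 := fun x p hp =>
    Finset.inf'_le (fun p : V × ℕ => p.2 + d x p.1) hp
  have hex : ∀ x, ∃ p ∈ P, f x = p.2 + d x p.1 := fun x =>
    Finset.exists_mem_eq_inf' hne fun p : V × ℕ => p.2 + d x p.1
  refine ⟨f, fun p hp => ?_, fun x => ?_, fun x y => ⟨?_, ?_⟩⟩
  · obtain ⟨q, hq, h⟩ := hex p.1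
    have h1 := hle p.1 p hp
    have h2 := (hP p hp q hq).1
    rw [hd.self] at h1
    omega
  · obtain ⟨q, hq, h⟩ := hex x
    have := hpos q hq
    omega
  · obtain ⟨q, hq, h⟩ := hex y
    have h1 := hle x q hq
    have h2 := hd.triangle x y q.1
    omega
  · obtain ⟨p, hp, h⟩ := hex x
    obtain ⟨q, hq, h'⟩ := hex y
    have h1 := (hP p hp q hq).2
    have h2 := hd.triangle x p.1 y
    have h3 := hd.triangle p.1 q.1 y
    rw [hd.symm q.1 y] at h3
    omega

/-- The functions under which the extension problem `P` has a solution, if it is admissible. -/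
def extensionSet {X V : Type*} (D : X → V → V → ℕ) (P : Finset (V × ℕ)) : Set X :=
  {a | IsKatetov (D a) P → (∀ p ∈ P, 1 ≤ p.2) → ∃ v, ∀ p ∈ P, D a v p.1 = p.2}

section Generic

variable {X V : Type*} [TopologicalSpace X] {D : X → V → V → ℕ}

/-- Admissibility is a closed condition, and being solved by a given point is an open one, as each
involves finitely many distances. -/
theorem isOpen_extensionSet (hD : ∀ x y, Continuous fun a => D a x y) (P : Finset (V × ℕ)) :
    IsOpen (extensionSet D P) := by
  have hK : IsClosed {a | IsKatetov (D a) P} := by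
    have : {a | IsKatetov (D a) P} = ⋂ p ∈ P, ⋂ q ∈ P,
        {a | p.2 ≤ q.2 + D a p.1 q.1 ∧ D a p.1 q.1 ≤ p.2 + q.2} := by
      ext a; simp only [IsKatetov, Set.mem_ofPred_eq, Set.mem_iInter]
    rw [this]
    refine isClosed_biInter fun p _ => isClosed_biInter fun q _ => ?_
    exact (isClosed_discrete {n : ℕ | p.2 ≤ q.2 + n ∧ n ≤ p.2 + q.2}).preimage (hD p.1 q.1)
  have hE : IsOpen {a | ∃ v, ∀ p ∈ P, D a v p.1 = p.2} := by
    have : {a | ∃ v, ∀ p ∈ P, D a v p.1 = p.2} = ⋃ v, ⋂ p ∈ P, {a | D a v p.1 = p.2} := by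
      ext a; simp only [Set.mem_ofPred_eq, Set.mem_iInter, Set.mem_iUnion]
    rw [this]
    refine isOpen_iUnion fun v => isOpen_biInter_finset fun p _ => ?_
    exact (isOpen_discrete {p.2}).preimage (hD v p.1)
  have : extensionSet D P = {a | IsKatetov (D a) P}ᶜ ∪
      ({_a | ¬ ∀ p ∈ P, 1 ≤ p.2} ∪ {a | ∃ v, ∀ p ∈ P, D a v p.1 = p.2}) := by
    ext a
    simp only [extensionSet, Set.mem_ofPred_eq, Set.mem_union, Set.mem_compl_iff]
    tauto
  rw [this]
  exact hK.isOpen_compl.union (isOpen_const.union hE)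

theorem isUrysohn_mem_residual [Countable V] (hD : ∀ x y, Continuous fun a => D a x y)
    (hmetric : ∀ a, IsNatMetric (D a)) (hdense : ∀ P, Dense (extensionSet D P)) :
    {a | IsUrysohn (D a)} ∈ residual X := by
  have : ⋂ P, extensionSet D P ∈ residual X := countable_iInter_mem.2 fun P =>
    residual_of_dense_open (isOpen_extensionSet hD P) (hdense P)
  refine Filter.mem_of_superset this fun a ha => ⟨hmetric a, fun P => ?_⟩
  exact Set.mem_iInter.1 ha P

/-- Density for the topology of pointwise convergence. -/
theorem dense_subtype_of_forall_finset {ι : Type*} {p : (ι → ℕ) → Prop} {s : Set {f // p f}}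
    (h : ∀ (f : {f // p f}) (F : Finset ι), ∃ g ∈ s, ∀ i ∈ F, g.1 i = f.1 i) : Dense s := by
  intro f
  rw [mem_closure_iff]
  intro U hU hf
  obtain ⟨W, hW, rfl⟩ := isOpen_induced_iff.1 hU
  obtain ⟨I, u, hu, hI⟩ := isOpen_pi_iff.1 hW f.1 hf
  obtain ⟨g, hg, hgf⟩ := h f I
  exact ⟨g, hI fun i hi => by rw [hgf i hi]; exact (hu i hi).2, hg⟩

end Generic

/-! ### Existence of an integral Urysohn metric -/

/-- There is an integral Urysohn metric on the natural numbers. -/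
theorem exists_isUrysohn_nat : ∃ d : ℕ → ℕ → ℕ, IsUrysohn d := by
  classical
  let p : (ℕ × ℕ → ℕ) → Prop := fun f => IsNatMetric fun x y => f (x, y)
  let D : {f // p f} → ℕ → ℕ → ℕ := fun f x y => f.1 (x, y)
  have hev : ∀ i : ℕ × ℕ, Continuous fun f : ℕ × ℕ → ℕ => f i := continuous_apply
  have hclosed : IsClosed {f | p f} := by
    have : {f | p f} = (⋂ x, ⋂ y, {f | f (x, y) = 0 ↔ x = y}) ∩
        ((⋂ x, ⋂ y, {f | f (x, y) = f (y, x)}) ∩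
          ⋂ x, ⋂ y, ⋂ z, {f | f (x, z) ≤ f (x, y) + f (y, z)}) := by
      ext f
      simp only [p, Set.mem_inter_iff, Set.mem_iInter, Set.mem_ofPred_eq]
      exact ⟨fun h => ⟨h.1, h.2, h.3⟩, fun h => ⟨h.1, h.2.1, h.2.2⟩⟩
    rw [this]
    refine .inter ?_ (.inter ?_ ?_)
    · refine isClosed_iInter fun x => isClosed_iInter fun y => ?_
      exact (isClosed_discrete {n : ℕ | n = 0 ↔ x = y}).preimage (hev (x, y))
    · exact isClosed_iInter fun x => isClosed_iInter fun y => isClosed_eq (hev _) (hev _)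
    · exact isClosed_iInter fun x => isClosed_iInter fun y => isClosed_iInter fun z =>
        isClosed_le (hev _) ((hev _).add (hev _))
  -- Being Polish makes the space of metrics Baire, so a generic metric exists.
  have : PolishSpace {f // p f} := hclosed.polishSpace
  have hdense : ∀ P, Dense (extensionSet D P) := fun P => by
    refine dense_subtype_of_forall_finset fun f F => ?_
    by_cases hf : f ∈ extensionSet D P
    · exact ⟨f, hf, fun _ _ => rfl⟩
    have hd : IsNatMetric (D f) := f.2
    simp only [extensionSet, Set.mem_ofPred_eq] at hf
    push Not at hf
    obtain ⟨hP, hpos, hno⟩ := hf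
    have hne : P.Nonempty := let ⟨q, hq, _⟩ := hno 0; ⟨q, hq⟩
    obtain ⟨k, hkP, hk1, hk⟩ := hP.exists_extension hd hpos hne
    -- A point not involved in `P` or `F` can be moved freely: its distances are overwritten by the
    -- Katetov function `k`.
    obtain ⟨v, hv⟩ := Infinite.exists_notMem_finset
      (P.image Prod.fst ∪ (F.image Prod.fst ∪ F.image Prod.snd))
    simp only [Finset.mem_union, not_or] at hv
    have hvP : ∀ q ∈ P, q.1 ≠ v := fun q hq h =>
      hv.1 (h ▸ Finset.mem_image_of_mem Prod.fst hq)
    have hvF : ∀ i ∈ F, i.1 ≠ v ∧ i.2 ≠ v := fun i hi =>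
      ⟨fun h => hv.2.1 (h ▸ Finset.mem_image_of_mem Prod.fst hi),
        fun h => hv.2.2 (h ▸ Finset.mem_image_of_mem Prod.snd hi)⟩
    let d' : ℕ → ℕ → ℕ := fun x y =>
      if x = v then (if y = v then 0 else k y) else if y = v then k x else D f x y
    have hd' : IsNatMetric d' := by
      refine ⟨fun x y => ?_, fun x y => ?_, fun x y z => ?_⟩
      · have h1 := hk1 x
        have h2 := hk1 y
        have h3 := hd.eq_zero_iff x y
        simp only [d']
        split_ifs <;> omega
      · have h3 := hd.symm x y
        simp only [d']
        split_ifs <;> omega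
      · have h1 := hk x y
        have h2 := hk y z
        have h3 := hk x z
        have h4 := hd.triangle x y z
        have h5 := hd.symm y z
        have h6 := hk z y
        simp only [d']
        split_ifs <;> omega
    refine ⟨⟨fun i => d' i.1 i.2, hd'⟩, fun _ _ => ⟨v, fun q hq => ?_⟩, fun i hi => ?_⟩
    · simp only [D, d', if_true, if_neg (hvP q hq), hkP q hq]
    · simp only [D, d', if_neg (hvF i hi).1, if_neg (hvF i hi).2]
  have hD : ∀ x y, Continuous fun a => D a x y := fun x y =>
    (hev (x, y)).comp continuous_subtype_val
  have : Nonempty {f // p f} := by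
    refine ⟨⟨fun i => if i.1 = i.2 then 0 else 1, ⟨fun x y => ?_, fun x y => ?_, fun x y z => ?_⟩⟩⟩
    · by_cases h : x = y <;> simp [h]
    · by_cases h : x = y <;> simp [h, eq_comm]
    · by_cases h : x = y <;> by_cases h' : y = z <;> simp_all <;> split_ifs <;> omega
  obtain ⟨a, ha⟩ := (dense_of_mem_residual
    (isUrysohn_mem_residual hD (fun a => a.2) hdense)).nonempty
  exact ⟨D a, ha⟩

/-! ### Moss graphs have Urysohn distance -/

theorem SimpleGraph.Connected.dist_map_le {V W : Type*} {H : SimpleGraph V} {K : SimpleGraph W}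
    (h : H.Connected) (f : H →g K) (x y : V) : K.dist (f x) (f y) ≤ H.dist x y := by
  obtain ⟨p, hp⟩ := h.exists_walk_length_eq_dist x y
  rw [← hp, ← p.length_map f]
  exact SimpleGraph.dist_le _

theorem SimpleGraph.Connected.dist_iso {V W : Type*} {H : SimpleGraph V} {K : SimpleGraph W}
    (h : H.Connected) (φ : H ≃g K) (x y : V) : K.dist (φ x) (φ y) = H.dist x y := by
  refine le_antisymm (h.dist_map_le φ.toHom x y) ?_
  simpa using (φ.connected_iff.1 h).dist_map_le φ.symm.toHom (φ x) (φ y)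

/-- A finite metric with natural number values is realised isometrically inside a finite connected
graph. -/
theorem IsNatMetric.exists_finite_connected {V : Type*} [Finite V] [Nonempty V] {d : V → V → ℕ}
    (hd : IsNatMetric d) :
    ∃ (n : ℕ) (K : SimpleGraph (Fin n)) (f : V → Fin n), K.Connected ∧
      ∀ x y, K.dist (f x) (f y) = d x y := by
  classical
  have := Fintype.ofFinite V
  obtain ⟨e, he⟩ := exists_isUrysohn_nat
  obtain ⟨g, hg⟩ := he.exists_isometry hd Finset.univ
  let U := he.toIsNatMetric.graph
  -- Adding one geodesic for each pair of image points yields a finite connected induced subgraph in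
  -- which their distances do not grow; in a subgraph they cannot shrink.
  choose w hw using fun x y : V => he.exists_walk (g x) (g y)
  let Z : Set ℕ := ⋃ x, ⋃ y, {z | z ∈ (w x y).support}
  have hZ : Z.Finite := Set.finite_iUnion fun x => Set.finite_iUnion fun y =>
    (w x y).support.finite_toSet
  have hwZ : ∀ x y, ∀ z ∈ (w x y).support, z ∈ Z := fun x y z hz =>
    Set.mem_iUnion₂.2 ⟨x, y, hz⟩
  have hgZ : ∀ x, g x ∈ Z := fun x => hwZ x x _ (SimpleGraph.Walk.start_mem_support _)
  have := hZ.fintype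
  let K := U.induce Z
  have hconn : K.Connected := by
    let x₀ := Classical.arbitrary V
    refine (SimpleGraph.connected_iff_exists_forall_reachable K).2 ⟨⟨g x₀, hgZ x₀⟩, ?_⟩
    rintro ⟨z, hz⟩
    obtain ⟨x, y, hz⟩ := Set.mem_iUnion₂.1 hz
    refine ⟨((w x₀ x).append ((w x y).takeUntil z hz)).induce Z fun u hu => ?_⟩
    rcases (SimpleGraph.Walk.mem_support_append_iff _ _).1 hu with hu | hu
    · exact hwZ _ _ _ hu
    · exact hwZ _ _ _ (SimpleGraph.Walk.support_takeUntil_subset_support _ _ hu)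
  have hdist : ∀ x y, K.dist ⟨g x, hgZ x⟩ ⟨g y, hgZ y⟩ = d x y := fun x y => by
    rw [← hg x (Finset.mem_univ _) y (Finset.mem_univ _)]
    refine le_antisymm ?_ ?_
    · have h := congrArg SimpleGraph.Walk.length ((w x y).map_induce (hwZ x y))
      rw [SimpleGraph.Walk.length_map] at h
      exact (SimpleGraph.dist_le _).trans (h.trans (hw x y)).le
    · rw [← he.graph_dist]
      exact hconn.dist_map_le (SimpleGraph.Embedding.induce Z).toHom ⟨g x, hgZ x⟩ ⟨g y, hgZ y⟩
  let φ := SimpleGraph.Iso.map (Fintype.equivFin Z) K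
  exact ⟨Fintype.card Z, _, fun x => φ ⟨g x, hgZ x⟩, φ.connected_iff.1 hconn, fun x y => by
    rw [hconn.dist_iso, hdist]⟩

/-- Universality places a copy of the finite set together with its new point somewhere in the graph;
homogeneity carries the copy of the set back onto the set, and the new point with it. -/
theorem IsMossGraph.isUrysohn {V : Type*} {H : SimpleGraph V} (hH : IsMossGraph H) :
    IsUrysohn H.dist := by
  classical
  have hd := hH.connected.isNatMetric
  refine ⟨hd, fun P hP hpos => ?_⟩
  by_cases hne : P.Nonempty
  swap
  · obtain ⟨v⟩ := hH.connected.nonempty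
    exact ⟨v, fun p hp => (hne ⟨p, hp⟩).elim⟩
  obtain ⟨k, hkP, hk1, hk⟩ := hP.exists_extension hd hpos hne
  let A : Finset V := P.image Prod.fst
  let e : Option A → Option A → ℕ := fun x y =>
    x.elim (y.elim 0 fun y => k y) fun x => y.elim (k x) fun y => H.dist (x : V) y
  have he : IsNatMetric e := by
    refine ⟨?_, ?_, ?_⟩
    · rintro (_ | x) (_ | y)
      · simp [e]
      · simpa [e] using Nat.one_le_iff_ne_zero.1 (hk1 y)
      · simpa [e] using Nat.one_le_iff_ne_zero.1 (hk1 x)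
      · exact (hd.eq_zero_iff _ _).trans
          (Subtype.ext_iff.symm.trans (Option.some_inj (a := x) (b := y)).symm)
    · rintro (_ | x) (_ | y)
      exacts [rfl, rfl, rfl, hd.symm _ _]
    · rintro (_ | x) (_ | y) (_ | z) <;> simp only [e, Option.elim]
      · omega
      · omega
      · omega
      · have := hk z y; rw [hd.symm z y] at this; omega
      · omega
      · exact (hk x z).2
      · have := hk x y; omega
      · exact hd.triangle _ _ _
  obtain ⟨n, K, f, hK, hf⟩ := he.exists_finite_connected
  obtain ⟨j, hj⟩ := hH.universal n K hK
  let i : A → V := fun a => j (f (some a))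
  have hi : ∀ a b : A, H.dist (i a) (i b) = H.dist (a : V) b := fun a b => by
    simp only [i, hj, hf]; rfl
  have hinj : Function.Injective i := fun a b h => by
    rw [Subtype.ext_iff, ← hd.eq_zero_iff, ← hi, h, hd.self]
  let ψ : Set.range i ≃ (A : Set V) := (Equiv.ofInjective i hinj).symm
  obtain ⟨φ, hφ⟩ := hH.homogeneous (Set.range i) A (Set.finite_range i) A.finite_toSet ψ (by
    rintro ⟨_, a, rfl⟩ ⟨_, b, rfl⟩
    have h : ∀ a, ψ ⟨i a, a, rfl⟩ = a := fun a => Equiv.ofInjective_symm_apply hinj a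
    rw [h, h, hi])
  have hφi : ∀ a : A, φ (i a) = a := fun a => by
    rw [hφ ⟨i a, a, rfl⟩]
    exact congrArg Subtype.val (Equiv.ofInjective_symm_apply hinj a)
  have hiso : ∀ x y, H.dist (φ x) (φ y) = H.dist x y := by
    exact hH.connected.dist_iso φ
  refine ⟨φ (j (f none)), fun p hp => ?_⟩
  have hpA : p.1 ∈ A := Finset.mem_image_of_mem _ hp
  have h := hφi ⟨p.1, hpA⟩
  dsimp only at h
  rw [← h, hiso, hj, hf]
  exact hkP p hp

theorem IsMossGraph.nonempty_iso {V W : Type*} {H : SimpleGraph V} {K : SimpleGraph W}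
    (hH : IsMossGraph H) (hK : IsMossGraph K) : Nonempty (H ≃g K) := by
  have := hH.countable
  have := hK.countable
  obtain ⟨φ, hφ, -⟩ := IsUrysohn.exists_equiv hH.isUrysohn hK.isUrysohn ⟨∅, by simp⟩
  exact ⟨⟨φ, fun {x y} => by rw [← SimpleGraph.dist_eq_one_iff_adj, hφ,
    SimpleGraph.dist_eq_one_iff_adj]⟩⟩

/-! ### The free product with an infinite cyclic group -/

/-- The free product of `G` and an infinite cyclic group, as an HNN extension over the trivial
subgroup. -/
abbrev AdjoinLetter (G : Type*) [Group G] : Type _ :=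
  HNNExtension G (⊥ : Subgroup G) (⊥ : Subgroup G) (MulEquiv.refl _)

namespace AdjoinLetter

open HNNExtension HNNExtension.NormalWord
open scoped commutatorElement

variable {G : Type*} [Group G]

/-- The inclusion of `G`. -/
abbrev base : G →* AdjoinLetter G := HNNExtension.of

/-- The free letter. -/
abbrev letter : AdjoinLetter G := HNNExtension.t

theorem mem_toSubgroup_bot (u : ℤˣ) (g : G) :
    g ∈ toSubgroup (⊥ : Subgroup G) (⊥ : Subgroup G) u ↔ g = 1 := by
  rw [toSubgroup]; split_ifs <;> exact Subgroup.mem_bot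

/-- The product of the elements `t ^ u * g` over a list of pairs `(u, g)`. -/
def listProd (l : List (ℤˣ × G)) : AdjoinLetter G :=
  (l.map fun x => letter ^ (x.1 : ℤ) * base x.2).prod

@[simp] theorem listProd_nil : listProd ([] : List (ℤˣ × G)) = 1 := rfl

@[simp] theorem listProd_cons (x : ℤˣ × G) (l : List (ℤˣ × G)) :
    listProd (x :: l) = letter ^ (x.1 : ℤ) * base x.2 * listProd l := by
  simp [listProd]

@[simp] theorem listProd_append (l l' : List (ℤˣ × G)) :
    listProd (l ++ l') = listProd l * listProd l' := by
  simp [listProd]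

/-- A list of pairs `(u, g)` is reduced if it does not contain `(u, 1), (-u, g)`. -/
def IsReduced (l : List (ℤˣ × G)) : Prop :=
  l.IsChain fun a b => a.2 = 1 → a.1 = b.1

theorem exists_isReduced (w : AdjoinLetter G) :
    ∃ g l, IsReduced l ∧ w = base g * listProd l := by
  obtain ⟨d⟩ := TransversalPair.nonempty G (⊥ : Subgroup G) (⊥ : Subgroup G)
  let n := NormalWord.equiv (MulEquiv.refl _) d w
  refine ⟨n.head, n.toList, n.chain.imp fun a b h ha => h ?_,
    ((NormalWord.equiv (MulEquiv.refl _) d).symm_apply_apply w).symm⟩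
  rw [mem_toSubgroup_bot, ha]

/-- Britton's lemma over the trivial subgroup. It compares only the exponents and the leading group
element, which is all that is needed below. -/
theorem isReduced_unique {g g' : G} {l l' : List (ℤˣ × G)} (hl : IsReduced l)
    (hl' : IsReduced l') (h : base g * listProd l = base g' * listProd l') :
    l.map Prod.fst = l'.map Prod.fst ∧ (l ≠ [] → g = g') := by
  have hc : ∀ l : List (ℤˣ × G), IsReduced l → l.IsChain fun a b =>
      a.2 ∈ toSubgroup (⊥ : Subgroup G) (⊥ : Subgroup G) a.1 → a.1 = b.1 := fun l hl =>
    hl.imp fun a b h ha => h ((mem_toSubgroup_bot _ _).1 ha)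
  obtain ⟨h1, h2⟩ := ReducedWord.map_fst_eq_and_of_prod_eq (MulEquiv.refl _)
    (w₁ := ⟨g, l, hc l hl⟩) (w₂ := ⟨g', l', hc l' hl'⟩) h
  refine ⟨h1, fun hne => ?_⟩
  obtain ⟨a, l, rfl⟩ := List.exists_cons_of_ne_nil hne
  exact inv_mul_eq_one.1 ((mem_toSubgroup_bot _ _).1 (h2 a.1 (by simp)))

theorem eq_nil_of_eq_base {g g' : G} {l : List (ℤˣ × G)} (hl : IsReduced l)
    (h : base g * listProd l = base g') : l = [] ∧ g = g' := by
  have h1 := (isReduced_unique hl (l' := []) List.isChain_nil (by simpa using h)).1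
  obtain rfl : l = [] := by simpa using h1
  exact ⟨rfl, HNNExtension.of_injective _ (by simpa using h)⟩

theorem isReduced_append_singleton {l : List (ℤˣ × G)} {u : ℤˣ} {g : G} (g' : G)
    (h : IsReduced (l ++ [(u, g)])) : IsReduced (l ++ [(u, g')]) := by
  obtain ⟨h1, -, h2⟩ := List.isChain_append.1 h
  exact List.isChain_append.2 ⟨h1, List.isChain_singleton _, fun x hx y hy hx1 => by
    simp only [List.head?_cons, Option.mem_def, Option.some.injEq] at hy
    subst hy
    exact h2 x hx (u, g) rfl hx1⟩

theorem isReduced_append {l l' : List (ℤˣ × G)} {u : ℤˣ} {g : G} (h : IsReduced (l ++ [(u, g)]))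
    (hg : g ≠ 1) (hl' : IsReduced l') : IsReduced (l ++ [(u, g)] ++ l') :=
  List.isChain_append.2 ⟨h, hl', fun x hx y _ hx1 => by
    simp only [List.getLast?_append, List.getLast?_singleton, Option.some_or, Option.mem_def,
      Option.some.injEq] at hx
    subst hx
    exact (hg hx1).elim⟩

theorem isReduced_cons {l : List (ℤˣ × G)} (u : ℤˣ) {g : G} (hg : g ≠ 1) (hl : IsReduced l) :
    IsReduced ((u, g) :: l) :=
  isReduced_append (l := []) (List.isChain_singleton _) hg hl

/-- Conjugates of the form `t * ⋯ * t⁻¹` can be multiplied, with a nontrivial element of `G` in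
between, without any cancellation. -/
theorem exists_conj [Infinite G] {w : AdjoinLetter G} (hw : w ≠ 1) :
    ∃ c g l, IsReduced ((1, g) :: (l ++ [(-1, 1)])) ∧
      c * w * c⁻¹ = listProd ((1, g) :: (l ++ [(-1, 1)])) := by
  classical
  obtain ⟨g₀, l, hl, rfl⟩ := exists_isReduced w
  rcases List.eq_nil_or_concat' l with rfl | ⟨l, ⟨u, g⟩, rfl⟩
  · refine ⟨letter, g₀, [], isReduced_cons 1 (fun h => hw (by simp [h])) (List.isChain_singleton _),
      ?_⟩
    simp
  -- Avoiding these two values keeps `k * g₀` and `g * k⁻¹` nontrivial, so conjugation by `t * k`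
  -- cancels nothing.
  · obtain ⟨k, hk⟩ := Infinite.exists_notMem_finset ({g₀⁻¹, g} : Finset G)
    simp only [Finset.mem_insert, Finset.mem_singleton, not_or] at hk
    refine ⟨letter * base k, k * g₀, l ++ [(u, g * k⁻¹)], ?_, ?_⟩
    · refine isReduced_cons 1 (fun h => hk.1 (eq_inv_of_mul_eq_one_left h)) ?_
      exact isReduced_append (isReduced_append_singleton _ hl)
        (fun h => hk.2 (mul_inv_eq_one.1 h).symm) (List.isChain_singleton _)
    · simp [mul_assoc]

/-- Any two nontrivial elements have conjugates that do not commute. -/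
theorem exists_not_commute [Infinite G] {w₁ w₂ : AdjoinLetter G} (h₁ : w₁ ≠ 1) (h₂ : w₂ ≠ 1) :
    ∃ u, ¬ Commute w₁ (u * w₂ * u⁻¹) := by
  obtain ⟨c₁, g₁, l₁, hr₁, hc₁⟩ := exists_conj h₁
  obtain ⟨c₂, g₂, l₂, hr₂, hc₂⟩ := exists_conj h₂
  obtain ⟨h, hh⟩ := exists_ne (1 : G)
  -- With this conjugator, the two products have reduced forms with leading elements 1 and `h`, so
  -- commuting would give `h = 1`.
  refine ⟨c₁⁻¹ * base h * c₂, fun hcomm => hh ?_⟩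
  have hcomm' : listProd ((1, g₁) :: (l₁ ++ [(-1, 1)])) *
      (base h * listProd ((1, g₂) :: (l₂ ++ [(-1, 1)])) * (base h)⁻¹) =
      (base h * listProd ((1, g₂) :: (l₂ ++ [(-1, 1)])) * (base h)⁻¹) *
        listProd ((1, g₁) :: (l₁ ++ [(-1, 1)])) := by
    rw [← hc₁, ← hc₂]
    have := congrArg (fun x => c₁ * x * c₁⁻¹) hcomm.eq
    simpa [mul_assoc] using this
  refine ((isReduced_unique (g := 1) (g' := h)
    (l := ((1, g₁) :: l₁) ++ [(-1, h)] ++ (((1, g₂) :: l₂) ++ [(-1, h⁻¹)]))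
    (l' := ((1, g₂) :: l₂) ++ [(-1, h⁻¹)] ++ (((1, g₁) :: l₁) ++ [(-1, 1)])) ?_ ?_ ?_).2
      (by simp)).symm
  · exact isReduced_append (isReduced_append_singleton (l := (1, g₁) :: l₁) _ hr₁) hh
      (isReduced_append_singleton (l := (1, g₂) :: l₂) _ hr₂)
  · exact isReduced_append (isReduced_append_singleton (l := (1, g₂) :: l₂) _ hr₂)
      (inv_ne_one.2 hh) hr₁
  · simpa [mul_assoc] using hcomm'

/-- Finitely many nontrivial elements can be kept nontrivial simultaneously by keeping a single
element nontrivial. -/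
theorem exists_witness [Infinite G] {K : Type*} [Group K] (S : Finset (AdjoinLetter G))
    (hS : 1 ∉ S) :
    ∃ w : AdjoinLetter G, w ≠ 1 ∧ ∀ ψ : AdjoinLetter G →* K, ψ w ≠ 1 → ∀ s ∈ S, ψ s ≠ 1 := by
  classical
  induction S using Finset.induction_on with
  | empty =>
    obtain ⟨h, hh⟩ := exists_ne (1 : G)
    exact ⟨base h, fun h1 => hh (HNNExtension.of_injective _ (by simpa using h1)), by simp⟩
  | insert a S ha ih =>
    simp only [Finset.mem_insert, not_or] at hS
    obtain ⟨w, hw, hψ⟩ := ih hS.2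
    obtain ⟨u, hu⟩ := exists_not_commute hw (Ne.symm hS.1)
    -- A homomorphism killing `w` or `a` also kills this commutator.
    refine ⟨⁅w, u * a * u⁻¹⁆, fun h => hu (commutatorElement_eq_one_iff_commute.1 h),
      fun ψ h s hs => ?_⟩
    rcases Finset.mem_insert.1 hs with rfl | hs
    · intro h'; exact h (by simp [map_commutatorElement, h'])
    · exact hψ ψ (fun h' => h (by simp [map_commutatorElement, h'])) s hs

theorem _root_.IsMIF.infinite (hG : IsMIF G) : Infinite G := by
  by_contra hfin
  have : Finite G := not_infinite_iff_finite.1 hfin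
  -- A finite group satisfies the identity `x ^ |G| = 1`.
  refine hG ⟨Monoid.Coprod.inr (Multiplicative.ofAdd 1) ^ Nat.card G, fun h => ?_, fun α _ => ?_⟩
  · have h' := congrArg (fun x => (Monoid.Coprod.snd x).toAdd) h
    simp only [map_pow, Monoid.Coprod.snd_apply_inr, map_one, toAdd_pow, toAdd_ofAdd, toAdd_one,
      nsmul_eq_mul, mul_one, Nat.cast_eq_zero] at h'
    exact Nat.card_pos.ne' h'
  · rw [map_pow, pow_card_eq_one']

/-- Over a mixed identity free group, finitely many nontrivial elements of `G ∗ ℤ` survive under a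
common retraction to `G`. -/
theorem _root_.IsMIF.exists_retraction (hG : IsMIF G) (S : Finset (AdjoinLetter G))
    (hS : 1 ∉ S) :
    ∃ β : AdjoinLetter G →* G, (∀ g, β (base g) = g) ∧ ∀ s ∈ S, β s ≠ 1 := by
  have := hG.infinite
  obtain ⟨w, hw, hψ⟩ := exists_witness (K := G) S hS
  let j : AdjoinLetter G →* Monoid.Coprod G (Multiplicative ℤ) :=
    HNNExtension.lift Monoid.Coprod.inl (Monoid.Coprod.inr (Multiplicative.ofAdd 1)) (by
      rintro ⟨a, ha⟩
      obtain rfl := Subgroup.mem_bot.1 ha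
      simp)
  let k : Monoid.Coprod G (Multiplicative ℤ) →* AdjoinLetter G :=
    Monoid.Coprod.lift base (zpowersHom _ letter)
  have hkj : k.comp j = MonoidHom.id _ := by
    refine HNNExtension.hom_ext ?_ ?_
    · ext g; simp [k, j]
    · simp [k, j]
  have hjw : j w ≠ 1 := fun h => hw (by
    have := DFunLike.congr_fun hkj w
    simpa [h] using this.symm)
  by_contra hno
  refine hG ⟨j w, hjw, fun α hα => ?_⟩
  by_contra hne
  exact hno ⟨α.comp j, fun g => by simp [j, hα], hψ (α.comp j) hne⟩

end AdjoinLetter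

/-! ### Weighted word lengths -/

/-- `WordCost E x n`: the element `x` is a product of letters of total cost `n`, where `E y k` says
that `y` is a letter of cost `k`. -/
inductive WordCost {H : Type*} [Group H] (E : H → ℕ → Prop) : H → ℕ → Prop
  | one : WordCost E 1 0
  | mul {x y : H} {m n : ℕ} : E x m → WordCost E y n → WordCost E (x * y) (m + n)

namespace WordCost

variable {H : Type*} [Group H] {E : H → ℕ → Prop}

theorem of_letter {x : H} {n : ℕ} (h : E x n) : WordCost E x n := by
  simpa using mul h one

theorem mul' {x y : H} {m n : ℕ} (hx : WordCost E x m) (hy : WordCost E y n) :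
    WordCost E (x * y) (m + n) := by
  induction hx with
  | one => simpa using hy
  | mul h _ ih => rw [mul_assoc, add_assoc]; exact mul h ih

theorem inv (hE : ∀ x n, E x n → E x⁻¹ n) {x : H} {n : ℕ} (hx : WordCost E x n) :
    WordCost E x⁻¹ n := by
  induction hx with
  | one => simpa using one
  | mul h _ ih => rw [mul_inv_rev, add_comm]; exact ih.mul' (of_letter (hE _ _ h))

theorem eq_one (hpos : ∀ x n, E x n → 1 ≤ n) {x : H} (hx : WordCost E x 0) : x = 1 := by
  generalize hk : 0 = k at hx
  cases hx with
  | one => rfl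
  | mul h _ => have := hpos _ _ h; omega

/-- Every letter costs at least 1, so a word of cost below `k` has fewer than `k` letters, each of
cost below `k`. -/
theorem finite (hpos : ∀ x n, E x n → 1 ≤ n) (k : ℕ) (hfin : {x | ∃ n < k, E x n}.Finite) :
    {x | ∃ n < k, WordCost E x n}.Finite := by
  suffices ∀ j ≤ k, {x | ∃ n < j, WordCost E x n}.Finite from this k le_rfl
  intro j
  induction j with
  | zero => simp
  | succ j ih =>
    intro hj
    refine ((Set.finite_singleton (1 : H)).union
      (Set.Finite.image2 (· * ·) hfin (ih (by omega)))).subset ?_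
    rintro x ⟨n, hn, hx⟩
    cases hx with
    | one => exact Or.inl rfl
    | mul h hy =>
      have := hpos _ _ h
      exact Or.inr ⟨_, ⟨_, by omega, h⟩, _, ⟨_, by omega, hy⟩, rfl⟩

end WordCost

theorem IsLengthFunction.isNatMetric {G : Type*} [Group G] {l : G → ℕ} (hl : IsLengthFunction l) :
    IsNatMetric fun a b => l (a⁻¹ * b) where
  eq_zero_iff a b := by rw [hl.eq_zero_iff, inv_mul_eq_one]
  symm a b := by rw [hl.map_inv]; simp
  triangle a b c := by simpa [mul_assoc] using hl.map_mul_le (a⁻¹ * b) (b⁻¹ * c)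

/-! ### Lower bounds for costs in the free product -/

namespace AdjoinLetter

variable {G : Type*} [Group G]

/-- The letters `g` of cost `W g`, and the letters `t⁻¹ * a` of cost `k` and their inverses, for
`(a, k)` in `P`. -/
inductive Letter (W : G → ℕ) (P : Finset (G × ℕ)) : AdjoinLetter G → ℕ → Prop
  | base (g : G) : Letter W P (base g) (W g)
  | left {p : G × ℕ} (hp : p ∈ P) : Letter W P (letter⁻¹ * base p.1) p.2
  | right {p : G × ℕ} (hp : p ∈ P) : Letter W P ((base p.1)⁻¹ * letter) p.2

theorem Letter.inv {W : G → ℕ} (hW : ∀ g, W g⁻¹ = W g) {P : Finset (G × ℕ)} (x : AdjoinLetter G)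
    (n : ℕ) (h : Letter W P x n) : Letter W P x⁻¹ n := by
  cases h with
  | base g => rw [← map_inv, ← hW]; exact .base _
  | left hp => simpa using Letter.right (W := W) hp
  | right hp => simpa using Letter.left (W := W) hp

/-- `SplitCost l P g L n`: in `g * listProd L`, each `t⁻¹` can be completed to a factor `t⁻¹ * a`
and each `t` to a factor `a⁻¹ * t` with `a` in `P`, such that the costs of these factors and the
lengths of the remaining ones sum to `n`. -/
inductive SplitCost (l : G → ℕ) (P : Finset (G × ℕ)) : G → List (ℤˣ × G) → ℕ → Prop
  | nil (g : G) : SplitCost l P g [] (l g)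
  | pos (g : G) {p : G × ℕ} (hp : p ∈ P) {h : G} {L : List (ℤˣ × G)} {n : ℕ} :
      SplitCost l P h L n → SplitCost l P (g * p.1⁻¹) ((1, h) :: L) (l g + p.2 + n)
  | neg (g : G) {p : G × ℕ} (hp : p ∈ P) {h : G} {L : List (ℤˣ × G)} {n : ℕ} :
      SplitCost l P h L n → SplitCost l P g ((-1, p.1 * h) :: L) (l g + p.2 + n)

variable {l W : G → ℕ} {P : Finset (G × ℕ)}

theorem SplitCost.base_mul (hl : IsLengthFunction l) {g : G} {L : List (ℤˣ × G)} {n : ℕ}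
    (h : SplitCost l P g L n) (k : G) : ∃ m ≤ l k + n, SplitCost l P (k * g) L m := by
  cases h with
  | nil => exact ⟨_, hl.map_mul_le k g, .nil _⟩
  | pos g hp h =>
    have := hl.map_mul_le k g
    have H := SplitCost.pos (k * g) hp h
    rw [mul_assoc] at H
    exact ⟨_, by omega, H⟩
  | neg g hp h =>
    have := hl.map_mul_le k g
    exact ⟨_, by omega, .neg (k * g) hp h⟩

theorem SplitCost.of_pos {g h : G} {L : List (ℤˣ × G)} {n : ℕ}
    (H : SplitCost l P g ((1, h) :: L) n) : ∃ m ≤ n, SplitCost l P h L m := by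
  generalize hL : (1, h) :: L = L' at H
  cases H with
  | nil => simp at hL
  | pos g hp H =>
    simp only [List.cons.injEq, Prod.mk.injEq, true_and] at hL
    obtain ⟨rfl, rfl⟩ := hL
    exact ⟨_, Nat.le_add_left _ _, H⟩
  | neg g hp H =>
    simp only [List.cons.injEq, Prod.mk.injEq] at hL
    exact absurd hL.1.1 (by decide)

theorem SplitCost.of_neg {g h : G} {L : List (ℤˣ × G)} {n : ℕ}
    (H : SplitCost l P g ((-1, h) :: L) n) :
    ∃ p ∈ P, ∃ m, p.2 + m ≤ n ∧ SplitCost l P (p.1⁻¹ * h) L m := by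
  generalize hL : (-1, h) :: L = L' at H
  cases H with
  | nil => simp at hL
  | pos g hp H =>
    simp only [List.cons.injEq, Prod.mk.injEq] at hL
    exact absurd hL.1.1 (by decide)
  | neg g hp H =>
    simp only [List.cons.injEq, Prod.mk.injEq, true_and] at hL
    obtain ⟨rfl, rfl⟩ := hL
    exact ⟨_, hp, _, (by rw [add_assoc]; exact Nat.le_add_left _ _), by simpa using H⟩

theorem isReduced_cons_or {L : List (ℤˣ × G)} (hL : IsReduced L) (u : ℤˣ) (g : G) :
    IsReduced ((u, g) :: L) ∨ g = 1 ∧ ∃ h L', L = (-u, h) :: L' := by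
  by_cases hg : g = 1
  swap
  · exact .inl (isReduced_cons u hg hL)
  rcases L with _ | ⟨⟨u', h⟩, L⟩
  · exact .inl (List.isChain_singleton _)
  by_cases hu : u = u'
  · exact .inl (List.isChain_cons_cons.2 ⟨fun _ => hu, hL⟩)
  · exact .inr ⟨hg, h, L, by rw [Int.units_ne_iff_eq_neg.1 (Ne.symm hu)]⟩

/-- Letters are multiplied on from the left, keeping the form reduced. A cancelling `t⁻¹ * t` only
discards cost; a cancelling `t * t⁻¹` merges factors `a⁻¹ * t` and `t⁻¹ * b` into `a⁻¹ * b`, whose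
length is at most the sum of their costs by the Katetov condition. -/
theorem exists_splitCost (hl : IsLengthFunction l) (hW : ∀ g, l g ≤ W g)
    (hP : IsKatetov (fun a b => l (a⁻¹ * b)) P) {x : AdjoinLetter G} {n : ℕ}
    (hx : WordCost (Letter W P) x n) :
    ∃ g L, IsReduced L ∧ x = base g * listProd L ∧ ∃ m ≤ n, SplitCost l P g L m := by
  have h1 : l 1 = 0 := (hl.eq_zero_iff 1).2 rfl
  induction hx with
  | one => exact ⟨1, [], List.isChain_nil, by simp, l 1, by omega, .nil 1⟩
  | mul hy _ ih =>
    obtain ⟨g, L, hL, rfl, m, hm, hc⟩ := ih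
    cases hy with
    | base k =>
      obtain ⟨m', hm', hc'⟩ := hc.base_mul hl k
      have := hW k
      exact ⟨k * g, L, hL, by simp [mul_assoc], m', by omega, hc'⟩
    | @left p hp =>
      rcases isReduced_cons_or hL (-1) (p.1 * g) with hr | ⟨hg, h, L, rfl⟩
      · exact ⟨1, _, hr, by simp [mul_assoc], _, by omega, .neg 1 hp hc⟩
      · obtain ⟨m', hm', hc'⟩ := hc.of_pos
        refine ⟨h, L, hL.tail, ?_, m', by omega, hc'⟩
        obtain rfl := eq_inv_of_mul_eq_one_right hg
        simp [mul_assoc]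
    | @right p hp =>
      rcases isReduced_cons_or hL 1 g with hr | ⟨rfl, h, L, rfl⟩
      · exact ⟨1 * p.1⁻¹, _, hr, by simp [mul_assoc], _, by omega, .pos 1 hp hc⟩
      · obtain ⟨q, hq, m', hm', hc'⟩ := hc.of_neg
        obtain ⟨m'', hm'', hc''⟩ := hc'.base_mul hl (p.1⁻¹ * q.1)
        have : l (p.1⁻¹ * q.1) ≤ p.2 + q.2 := (hP p hp q hq).2
        exact ⟨_, L, hL.tail, by simp [mul_assoc], m'', by omega, hc''⟩

theorem le_of_wordCost_base (hl : IsLengthFunction l) (hW : ∀ g, l g ≤ W g)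
    (hP : IsKatetov (fun a b => l (a⁻¹ * b)) P) {g : G} {n : ℕ}
    (hx : WordCost (Letter W P) (base g) n) : l g ≤ n := by
  obtain ⟨g', L, hL, he, m, hm, hc⟩ := exists_splitCost hl hW hP hx
  obtain ⟨rfl, rfl⟩ := eq_nil_of_eq_base hL he.symm
  cases hc
  exact hm

/-- A splitting of `t⁻¹ * a` uses some `(b, k)` in `P` and costs at least `k + l (b⁻¹ * a)`; the
Katetov condition bounds this below by the value prescribed at `a`. -/
theorem le_of_wordCost_left (hl : IsLengthFunction l) (hW : ∀ g, l g ≤ W g)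
    (hP : IsKatetov (fun a b => l (a⁻¹ * b)) P) {p : G × ℕ} (hp : p ∈ P) {n : ℕ}
    (hx : WordCost (Letter W P) (letter⁻¹ * base p.1) n) : p.2 ≤ n := by
  obtain ⟨g, L, hL, he, m, hm, hc⟩ := exists_splitCost hl hW hP hx
  obtain ⟨h1, h2⟩ := isReduced_unique hL (l' := [(-1, p.1)]) (g' := 1) (List.isChain_singleton _)
    (by rw [← he]; simp)
  rcases L with _ | ⟨⟨u, h⟩, L⟩
  · simp at h1
  simp only [List.map_cons, List.map_nil, List.cons.injEq, List.map_eq_nil_iff] at h1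
  obtain ⟨rfl, rfl⟩ := h1
  obtain rfl := h2 (by simp)
  have h3 : p.1 = h := HNNExtension.of_injective (φ := MulEquiv.refl (⊥ : Subgroup G))
    (by simpa using he)
  obtain ⟨q, hq, m', hm', hc'⟩ := hc.of_neg
  generalize hk : q.1⁻¹ * h = k at hc'
  cases hc'
  have h4 : p.2 ≤ q.2 + l (p.1⁻¹ * q.1) := (hP p hp q hq).1
  have h5 := hl.map_inv (p.1⁻¹ * q.1)
  simp only [mul_inv_rev, inv_inv] at h5
  rw [h5, h3, hk] at h4
  omega

end AdjoinLetter

/-! ### Generic length functions -/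

open AdjoinLetter in
/-- Over a mixed identity free group, every admissible one-point extension problem for a length
function is solved by a length function that agrees with it on a prescribed finite set. -/
theorem IsMIF.exists_lengthFunction {G : Type*} [Group G] (hG : IsMIF G) (l : LengthFunction G)
    (F : Finset G) (P : Finset (G × ℕ)) (hP : IsKatetov (fun a b => l.1 (a⁻¹ * b)) P)
    (hpos : ∀ p ∈ P, 1 ≤ p.2) :
    ∃ l' : LengthFunction G, (∀ g ∈ F, l'.1 g = l.1 g) ∧ ∃ v, ∀ p ∈ P, l'.1 (v⁻¹ * p.1) = p.2 := by
  classical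
  obtain ⟨l, hl⟩ := l
  dsimp only at hP ⊢
  -- `M` exceeds twice every value that must be preserved.
  let M : ℕ := 2 * (F.sup l + P.sup Prod.snd) + 1
  have hMF : ∀ g ∈ F, l g + l g < M := fun g hg => by
    have := Finset.le_sup (f := l) hg
    omega
  have hMP : ∀ p ∈ P, p.2 + p.2 < M := fun p hp => by
    have := Finset.le_sup (f := Prod.snd) hp
    omega
  -- Every element of `G` is a letter, so costs are finite, but only those in `F` or its inverse can
  -- cost less than `M`. The `max 1` keeps the letter 1 from being free.
  let W : G → ℕ := fun g => if g ∈ F ∨ g⁻¹ ∈ F then max 1 (l g) else max M (l g)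
  have hW : ∀ g, l g ≤ W g := fun g => by simp only [W]; split_ifs <;> omega
  have hW1 : ∀ g, 1 ≤ W g := fun g => by simp only [W]; split_ifs <;> omega
  have hWinv : ∀ g, W g⁻¹ = W g := fun g => by
    simp only [W, inv_inv, ← hl.map_inv, or_comm]
  have hWF : ∀ g ∈ F, g ≠ 1 → W g = l g := fun g hg hg1 => by
    have := mt (hl.eq_zero_iff g).1 hg1
    simp only [W, hg, true_or, if_true]
    omega
  let E := Letter W P
  have hEpos : ∀ x n, E x n → 1 ≤ n := by
    rintro x n (g | hp | hp)
    exacts [hW1 g, hpos _ hp, hpos _ hp]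
  have hEinv : ∀ x n, E x n → E x⁻¹ n := Letter.inv hWinv
  have hEfin : {x | ∃ n < M, E x n}.Finite := by
    refine (((F ∪ F.image (·⁻¹)).image base ∪ (P.image fun p => letter⁻¹ * base p.1) ∪
      P.image fun p => (base p.1)⁻¹ * letter).finite_toSet).subset ?_
    rintro x ⟨n, hn, (g | hp | hp)⟩
    · have hg : g ∈ F ∨ g⁻¹ ∈ F := by
        by_contra h
        simp only [W, h, if_false] at hn
        omega
      simp only [Finset.coe_union, Set.mem_union, Finset.mem_coe]
      refine .inl (.inl (Finset.mem_image_of_mem _ (Finset.mem_union.2 ?_)))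
      exact hg.imp id fun h => Finset.mem_image.2 ⟨g⁻¹, h, inv_inv g⟩
    · simp only [Finset.coe_union, Set.mem_union, Finset.mem_coe]
      exact .inl (.inr (Finset.mem_image_of_mem (fun p : G × ℕ => letter⁻¹ * base p.1) hp))
    · simp only [Finset.coe_union, Set.mem_union, Finset.mem_coe]
      exact .inr (Finset.mem_image_of_mem (fun p : G × ℕ => (base p.1)⁻¹ * letter) hp)
  have hfin := WordCost.finite hEpos M hEfin
  obtain ⟨β, hβ, hβS⟩ := hG.exists_retraction (hfin.toFinset.erase 1) (Finset.notMem_erase _ _)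
  have hβ1 : ∀ x n, n < M → WordCost E x n → β x = 1 → x = 1 := fun x n hn hx h => by
    by_contra hx1
    exact hβS x (Finset.mem_erase.2 ⟨hx1, hfin.mem_toFinset.2 ⟨n, hn, hx⟩⟩) h
  let R : G → Set ℕ := fun g => {n | ∃ x, β x = g ∧ WordCost E x n}
  have hR : ∀ g, (R g).Nonempty := fun g => ⟨W g, base g, hβ g, .of_letter (.base g)⟩
  -- The new length is the least cost of a preimage under `β`.
  let l' : G → ℕ := fun g => sInf (R g)
  have hmem : ∀ g, ∃ x, β x = g ∧ WordCost E x (l' g) := fun g => Nat.sInf_mem (hR g)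
  have hle : ∀ x n, WordCost E x n → l' (β x) ≤ n := fun x n hx => Nat.sInf_le ⟨x, rfl, hx⟩
  have hinv : ∀ g, l' g⁻¹ ≤ l' g := fun g => by
    obtain ⟨x, rfl, hc⟩ := hmem g
    rw [← map_inv]
    exact hle _ _ (hc.inv hEinv)
  have hl' : IsLengthFunction l' := by
    refine ⟨fun g => ⟨fun h => ?_, ?_⟩, fun g => le_antisymm ?_ (hinv g), fun g h => ?_⟩
    · obtain ⟨x, rfl, hc⟩ := hmem g
      rw [h] at hc
      rw [hc.eq_one hEpos, map_one]
    · rintro rfl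
      simpa using hle 1 0 .one
    · simpa using hinv g⁻¹
    · obtain ⟨x, hx, hc⟩ := hmem g
      obtain ⟨y, hy, hc'⟩ := hmem h
      rw [← hx, ← hy, ← map_mul, hx, hy]
      exact hle _ _ (hc.mul' hc')
  -- A cheaper `y` with the same image would make `y⁻¹ * x` an element of cost below `M` killed by
  -- `β`, hence trivial.
  have key : ∀ x k, WordCost E x k → k + k < M → (∀ n, WordCost E x n → k ≤ n) →
      l' (β x) = k := fun x k hx hk hmin => by
    refine le_antisymm (hle x k hx) ?_
    by_contra hlt
    obtain ⟨y, hy, hc⟩ := hmem (β x)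
    have h1 := hβ1 _ _ (by omega) ((hc.inv hEinv).mul' hx) (by simp [hy])
    rw [inv_mul_eq_one.1 h1] at hc
    exact hlt (hmin _ hc)
  refine ⟨⟨l', hl'⟩, fun g hg => ?_, β letter, fun p hp => ?_⟩
  · by_cases hg1 : g = 1
    · rw [hg1, (hl.eq_zero_iff 1).2 rfl]
      exact (hl'.eq_zero_iff 1).2 rfl
    · have h := key (base g) (l g) (by rw [← hWF g hg hg1]; exact .of_letter (.base g))
        (hMF g hg) fun n hn => le_of_wordCost_base hl hW hP hn
      rwa [hβ] at h
  · have h := key (letter⁻¹ * base p.1) p.2 (.of_letter (.left hp)) (hMP p hp)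
      fun n hn => le_of_wordCost_left hl hW hP hp hn
    rwa [map_mul, map_inv, hβ] at h

/-- The Cayley graph metric of a generic length function is an integral Urysohn metric. -/
theorem IsMIF.isUrysohn_mem_residual {G : Type*} [Group G] [Countable G] (hG : IsMIF G) :
    {l : LengthFunction G | IsUrysohn fun a b => l.1 (a⁻¹ * b)} ∈ residual (LengthFunction G) := by
  refine _root_.isUrysohn_mem_residual (D := fun (l : LengthFunction G) a b => l.1 (a⁻¹ * b))
    (fun a b => (continuous_apply (a⁻¹ * b)).comp continuous_subtype_val)
    (fun l => l.2.isNatMetric) fun P => dense_subtype_of_forall_finset fun l F => ?_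
  by_cases hP : IsKatetov (fun a b => l.1 (a⁻¹ * b)) P ∧ ∀ p ∈ P, 1 ≤ p.2
  · obtain ⟨l', hF, hv⟩ := hG.exists_lengthFunction l F P hP.1 hP.2
    exact ⟨l', fun _ _ => hv, hF⟩
  · exact ⟨l, fun h h' => (hP ⟨h, h'⟩).elim, fun _ _ => rfl⟩

/-- The unit sphere generates: a geodesic from 1 to `g` spells `g` as a product of `l g` elements of
length 1. -/
theorem IsUrysohn.isWordLength {G : Type*} [Group G] {l : LengthFunction G}
    (hd : IsUrysohn fun a b => l.1 (a⁻¹ * b)) : IsWordLength l := by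
  have h1 : l.1 1 = 0 := (l.2.eq_zero_iff 1).2 rfl
  have hword : ∀ n g, l.1 g = n →
      ∃ w : List G, (∀ x ∈ w, l.1 x = 1) ∧ w.prod = g ∧ w.length = n := by
    intro n
    induction n with
    | zero => exact fun g hg => ⟨[], by simp, by simpa using ((l.2.eq_zero_iff g).1 hg).symm, rfl⟩
    | succ n ih =>
      intro g hg
      obtain ⟨v, hv, hv'⟩ := hd.exists_intermediate (x := 1) (y := g) (by simpa using hg)
      obtain ⟨w, hw, hwp, hwl⟩ := ih _ hv'
      refine ⟨v :: w, fun x hx => ?_, by simp [hwp], by simp [hwl]⟩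
      rcases List.mem_cons.1 hx with rfl | hx
      · simpa using hv
      · exact hw x hx
  refine ⟨{g | l.1 g = 1}, (Subgroup.eq_top_iff' _).2 fun g => ?_, fun g => ⟨?_, ?_⟩⟩
  · obtain ⟨w, hw, rfl, -⟩ := hword _ g rfl
    exact Subgroup.list_prod_mem _ fun x hx => Subgroup.subset_closure (hw x hx)
  · obtain ⟨w, hw, hwp, hwl⟩ := hword _ g rfl
    exact ⟨w, fun x hx => .inl (hw x hx), hwp, hwl⟩
  · rintro n ⟨w, hw, rfl, rfl⟩
    induction w with
    | nil => simp [h1]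
    | cons x w ih =>
      have hx : l.1 x = 1 := by
        rcases hw x (by simp) with h | h
        · exact h
        · rw [l.2.map_inv]; exact h
      have h2 := l.2.map_mul_le x w.prod
      have h3 := ih fun y hy => hw y (by simp [hy])
      rw [List.prod_cons, List.length_cons]
      omega

/-- There is a countable graph `U`, unique up to isomorphism, with the defining properties of the
Moss graph; and, for every countable MIF group `G`, a generic length function on `G` is a word
length whose Cayley graph is isomorphic to `U`. -/
theorem theorem1p4 :
    ∃ U : SimpleGraph ℕ, IsMossGraph U ∧
      (∀ (V : Type*) (H : SimpleGraph V), IsMossGraph H → Nonempty (H ≃g U)) ∧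
      ∀ (G : Type*) [Group G] [Countable G], IsMIF G →
        ∃ C : Set (LengthFunction G), C ∈ residual (LengthFunction G) ∧
          ∀ l ∈ C, IsWordLength l ∧ Nonempty (cayleyGraph l ≃g U) := by
  obtain ⟨d, hd⟩ := exists_isUrysohn_nat
  refine ⟨hd.toIsNatMetric.graph, hd.isMossGraph, fun V H hH => hH.nonempty_iso hd.isMossGraph,
    fun G _ _ hG => ⟨_, hG.isUrysohn_mem_residual, fun l hl => ⟨hl.isWordLength, ?_⟩⟩⟩
  -- `cayleyGraph l` is by definition the distance-one graph of `l (a⁻¹ * b)`.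
  exact hl.nonempty_iso hd
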